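/- Let $\mathbf z=(z_1,\dots,z_n)$ be a real random vector on a probability space. Call $\mathbf z$ pairwise mean independent if, for all $i\neq j$, $z_i$ is integrable and $\mathbb E(z_i\mid z_j)=\mathbb E(z_i)$ almost surely. For $d\ge 2$ let $S^d(\mathbb R^n)$ be the space of real symmetric $n\times\cdots\times n$ tensors of order $d$, and let $$V^{d,n}_{\mathrm{pmi}}=\{T\in S^d(\mathbb R^n)\;:\;T_{ij\cdots j}=0\text{ for all } i\neq j\}.$$ Let $K_{\mathbf z}(t)=\log \mathbb E(e^{t^\top \mathbf z})$, $t\in\mathbb R^n$, be the cumulant generating function. The $d$-th cumulant tensor $\kappa_d(\mathbf z)$ has entries $$\kappa_d(\mathbf z)_{i_1,\dots,i_d}=\frac{\partial^d}{\partial t_{i_1}\cdots\partial t_{i_d}}K_{\mathbf z}(t)\Big|_{t=0}$$ when $K_{\mathbf z}$ is finite in a neighbourhood of $0$, and, whenever all moments $\mathbb E(z_{i_1}\cdots z_{i_d})$ of order $d$ exist, $$\kappa_d(\mathbf z)_{i_1,\dots,i_d}=\sum_{\pi}(-1)^{|\pi|-1}(|\pi|-1)!\prod_{B\in\pi}\mathbb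 E\Big(\prod_{k\in B}z_{i_k}\Big),$$ where $\pi$ runs over the set partitions of $\{1,\dots,d\}$ and $|\pi|$ is the number of blocks of $\pi$. With either description of $\kappa_d(\mathbf z)$, wherever it applies, the following holds. 1. If $\mathbf z$ is pairwise mean independent, then $\kappa_d(\mathbf z)\in V^{d,n}_{\mathrm{pmi}}$ for every $d\ge 2$ for which the moments of order $d$ exist. 2. Conversely, if $K_{\mathbf z}$ is finite in a neighbourhood of $0$ and $\kappa_d(\mathbf z)\in V^{d,n}_{\mathrm{pmi}}$ for all $d\ge 2$, then $\mathbf z$ is pairwise mean independent. -/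

import Mathlib

open MeasureTheory Finset
open scoped Nat Topology Matrix

noncomputable section

/-- The space `S^d(ℝⁿ)` of real symmetric `n × ⋯ × n` tensors of order `d`. -/
def SymTensor (d n : ℕ) : Submodule ℝ ((Fin d → Fin n) → ℝ) where
  carrier := {T | ∀ (σ : Equiv.Perm (Fin d)) (i : Fin d → Fin n), T (i ∘ σ) = T i}
  zero_mem' := fun _ _ => rfl
  add_mem' := fun {S T} hS hT σ i => by
    simp only [Pi.add_apply]
    rw [hS σ i, hT σ i]
  smul_mem' := fun c T hT σ i => by
    simp only [Pi.smul_apply]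
    rw [hT σ i]

/-- The multi-index `(i, j, …, j)` of length `d`. -/
def headIndex {n : ℕ} (d : ℕ) (i j : Fin n) : Fin d → Fin n :=
  fun k => if (k : ℕ) = 0 then i else j

/-- The linear space of symmetric tensors `T` of order `d` with `T_{ij…j} = 0` for all `i ≠ j`. -/
def Vpmi (d n : ℕ) : Submodule ℝ ((Fin d → Fin n) → ℝ) where
  carrier := {T | T ∈ SymTensor d n ∧ ∀ i j : Fin n, i ≠ j → T (headIndex d i j) = 0}
  zero_mem' := ⟨Submodule.zero_mem _, fun _ _ _ => rfl⟩
  add_mem' := fun {S T} hS hT => ⟨Submodule.add_mem _ hS.1 hT.1, fun i j h => by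
    simp only [Pi.add_apply]
    rw [hS.2 i j h, hT.2 i j h, add_zero]⟩
  smul_mem' := fun c T hT => ⟨Submodule.smul_mem _ c hT.1, fun i j h => by
    simp only [Pi.smul_apply]
    rw [hT.2 i j h, smul_zero]⟩

/-- The random vector `z` is pairwise mean independent: for all `i ≠ j`, the coordinate `z_i` has
an expectation and `E(z_i ∣ z_j) = E(z_i)` almost surely. -/
def PairwiseMeanIndependent {Ω : Type*} [MeasurableSpace Ω] {n : ℕ}
    (z : Ω → Fin n → ℝ) (P : Measure Ω) : Prop :=
  ∀ i j : Fin n, i ≠ j → Integrable (fun ω => z ω i) P ∧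
    P[fun ω => z ω i | MeasurableSpace.comap (fun ω => z ω j) inferInstance]
      =ᵐ[P] fun _ => ∫ ω, z ω i ∂P

/-- All moments `E(z_{i_1} ⋯ z_{i_d})` of order `d` exist. -/
def MomentsExist {Ω : Type*} [MeasurableSpace Ω] {n : ℕ}
    (z : Ω → Fin n → ℝ) (P : Measure Ω) (d : ℕ) : Prop :=
  ∀ i : Fin d → Fin n, Integrable (fun ω => ∏ k, z ω (i k)) P

/-- The cumulant generating function `K_z(t) = log E(exp(tᵀ z))`. -/
def cumulantGenFun {Ω : Type*} [MeasurableSpace Ω] {n : ℕ}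
    (z : Ω → Fin n → ℝ) (P : Measure Ω) (t : Fin n → ℝ) : ℝ :=
  Real.log (∫ ω, Real.exp (t ⬝ᵥ z ω) ∂P)

/-- `K_z` is finite in a neighbourhood of `0`. -/
def CGFFiniteNearZero {Ω : Type*} [MeasurableSpace Ω] {n : ℕ}
    (z : Ω → Fin n → ℝ) (P : Measure Ω) : Prop :=
  ∀ᶠ t : Fin n → ℝ in 𝓝 0, Integrable (fun ω => Real.exp (t ⬝ᵥ z ω)) P

/-- The `d`-th cumulant tensor as the tensor of `d`-th order partial derivatives of `K_z` at `0`;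
meaningful when `K_z` is finite (hence smooth) near `0`. -/
def cgfCumulantTensor {Ω : Type*} [MeasurableSpace Ω] {n : ℕ}
    (z : Ω → Fin n → ℝ) (P : Measure Ω) (d : ℕ) : (Fin d → Fin n) → ℝ :=
  fun i => iteratedFDeriv ℝ d (cumulantGenFun z P) 0 (fun k => Pi.single (i k) 1)

/-- The `d`-th cumulant tensor (`d ≥ 1`) in terms of moments,
`∑_π (-1)^{|π|-1} (|π|-1)! ∏_{B ∈ π} E(∏_{k ∈ B} z_{i_k})`, the sum being over all set partitions
of the `d` positions; meaningful as soon as the moments of order `d` exist. -/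
def momentCumulantTensor {Ω : Type*} [MeasurableSpace Ω] {n : ℕ}
    (z : Ω → Fin n → ℝ) (P : Measure Ω) (d : ℕ) : (Fin d → Fin n) → ℝ :=
  fun i => ∑ π : Finpartition (univ : Finset (Fin d)),
    (-1 : ℝ) ^ (#π.parts - 1) * ((#π.parts - 1)! : ℝ) *
      ∏ B ∈ π.parts, ∫ ω, ∏ k ∈ B, z ω (i k) ∂P

end

/- If `E(z_i ∣ z_j)` is a constant `c`, then `E(z_i z_j^k) = c E(z_j^k)` for all `k`. Group the
partitions in `κ_{ij⋯j}` by their restriction `ρ` to the positions of `j`. If `ρ` has `r + 1`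
blocks, then adjoining the position of `i` to one of them or making it a block of its own gives the
same product of moments, with total coefficient
`(r + 1) (-1)^r r! + (-1)^(r + 1) (r + 1)! = 0`. When the moment identities are known only for
`k < d`, the same computation gives `κ_{ij⋯j} = E(z_i z_j^d) - c E(z_j^d)`, so conversely the
vanishing of all these entries yields the moment identities by induction.

For `K_z`, the function `s ↦ ∂_i K_z(s e_j)` is the quotient of `E(z_i exp(s z_j))` by
`E(exp(s z_j))`, and the entries `κ_{ij⋯j}` are its derivatives at `0`. By analyticity they all
vanish iff the quotient is constantly `E z_i` near `0`, that is `E((z_i - E z_i) exp(s z_j)) = 0`;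
summing the exponential series, the moment identities give the same. Writing `z_i - E z_i` as a
difference of nonnegative weights, this says that two finite measures have the same moment
generating function of `z_j`, hence the same image under `z_j`, which is
`E(z_i ∣ z_j) = E z_i`. -/

section PartitionCumulant

variable {α : Type*} [DecidableEq α] {s : Finset α} {a : α}

theorem sup_parts_erase_eq_sdiff {ρ : Finpartition s} {B : Finset α}
    (hB : B ∈ insert ∅ ρ.parts) : (ρ.parts.erase B).sup id = s \ B := by
  rcases mem_insert.1 hB with rfl | hB
  · rw [erase_eq_of_notMem ρ.empty_notMem_parts, ρ.sup_parts, sdiff_empty]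
  · ext x
    simp only [mem_sup, mem_erase, id_eq, mem_sdiff]
    constructor
    · rintro ⟨C, ⟨hCB, hC⟩, hx⟩
      exact ⟨ρ.subset hC hx, fun hxB => hCB (ρ.eq_of_mem_parts hC hB hx hxB)⟩
    · rintro ⟨hxs, hxB⟩
      obtain ⟨C, hC, hx⟩ := ρ.exists_mem hxs
      exact ⟨C, ⟨fun h => hxB (h ▸ hx), hC⟩, hx⟩

theorem subset_of_mem_insert_empty_parts {ρ : Finpartition s} {B : Finset α}
    (hB : B ∈ insert ∅ ρ.parts) : B ⊆ s :=
  (mem_insert.1 hB).elim (fun h => h ▸ empty_subset s) ρ.subset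

/-- The set partition of `insert a s` obtained from a set partition `ρ` of `s` by adjoining `a` to
the block `B`. The choice `B = ∅` stands for adjoining `{a}` as a new block. -/
def adjoinToBlock (ha : a ∉ s) (ρ : Finpartition s) (B : Finset α) (hB : B ∈ insert ∅ ρ.parts) :
    Finpartition (insert a s) :=
  (ρ.ofSubset (erase_subset B ρ.parts) (sup_parts_erase_eq_sdiff hB)).extend (b := insert a B)
    (insert_ne_empty a B)
    (disjoint_insert_right.2 ⟨fun h => ha (mem_sdiff.1 h).1, sdiff_disjoint⟩)
    (by rw [sup_eq_union, union_insert, sdiff_union_of_subset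
      (subset_of_mem_insert_empty_parts hB)])

theorem part_adjoinToBlock (ha : a ∉ s) (ρ : Finpartition s) (B : Finset α)
    (hB : B ∈ insert ∅ ρ.parts) : (adjoinToBlock ha ρ B hB).part a = insert a B :=
  Finpartition.part_eq_of_mem _ (mem_insert_self _ _) (mem_insert_self _ _)

theorem parts_avoid_singleton (ha : a ∈ s) (π : Finpartition s) :
    (π.avoid {a}).parts =
      (insert ((π.part a).erase a) (π.parts.erase (π.part a))).erase ∅ := by
  have haC : ∀ C ∈ π.parts.erase (π.part a), C \ {a} = C := fun C hC => by
    rw [sdiff_singleton_eq_erase, erase_eq_of_notMem fun h =>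
      ne_of_mem_erase hC (π.part_eq_of_mem (mem_of_mem_erase hC) h).symm]
  change (π.parts.image (· \ {a})).erase ∅ = _
  conv_lhs => rw [← insert_erase (π.part_mem.2 ha), image_insert, sdiff_singleton_eq_erase,
    image_congr (g := id) haC, image_id]

theorem parts_adjoinToBlock_avoid (ha : a ∉ s) (ρ : Finpartition s) (B : Finset α)
    (hB : B ∈ insert ∅ ρ.parts) : ((adjoinToBlock ha ρ B hB).avoid {a}).parts = ρ.parts := by
  have hnew : insert a B ∉ ρ.parts.erase B := fun h =>
    ha (ρ.subset (mem_of_mem_erase h) (mem_insert_self _ _))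
  have hparts : (adjoinToBlock ha ρ B hB).parts = insert (insert a B) (ρ.parts.erase B) := rfl
  rw [parts_avoid_singleton (mem_insert_self a s), part_adjoinToBlock,
    erase_insert fun h => ha (subset_of_mem_insert_empty_parts hB h), hparts, erase_insert hnew]
  rcases mem_insert.1 hB with rfl | hB
  · rw [erase_insert (notMem_erase _ _), erase_eq_of_notMem ρ.empty_notMem_parts]
  · rw [insert_erase hB, erase_eq_of_notMem ρ.empty_notMem_parts]

theorem insert_part_erase_parts_avoid (ha : a ∈ s) (π : Finpartition s) :
    insert (π.part a) ((π.avoid {a}).parts.erase ((π.part a).erase a)) = π.parts := by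
  have hpart : π.part a ∈ π.parts := π.part_mem.2 ha
  have hnew : (π.part a).erase a ∉ π.parts.erase (π.part a) := fun h => by
    obtain ⟨x, hx⟩ := π.nonempty_of_mem_parts (mem_of_mem_erase h)
    exact ne_of_mem_erase h
      (π.eq_of_mem_parts (mem_of_mem_erase h) hpart hx (mem_of_mem_erase hx))
  rw [parts_avoid_singleton ha, erase_right_comm, erase_insert hnew,
    erase_eq_of_notMem fun h => π.empty_notMem_parts (mem_of_mem_erase h), insert_erase hpart]

theorem sum_finpartition_insert {M : Type*} [AddCommMonoid M] (ha : a ∉ s)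
    (f : Finset (Finset α) → M) :
    ∑ π : Finpartition (insert a s), f π.parts =
      ∑ ρ : Finpartition s, ∑ B ∈ insert ∅ ρ.parts, f (insert (insert a B) (ρ.parts.erase B)) := by
  have hs : insert a s \ {a} = s := by rw [sdiff_singleton_eq_erase, erase_insert ha]
  have has : a ∈ insert a s := mem_insert_self a s
  rw [sum_sigma']
  refine (sum_bij' (fun x hx => adjoinToBlock ha x.1 x.2 (mem_sigma.1 hx).2)
    (fun π _ => ⟨(π.avoid {a}).copy hs, (π.part a).erase a⟩) (fun _ _ => mem_univ _)
    (fun π _ => ?_) (fun x hx => ?_) (fun π _ => Finpartition.ext ?_) fun _ _ => rfl).symm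
  · rw [mem_sigma, Finpartition.copy_parts, parts_avoid_singleton has]
    exact ⟨mem_univ _, insert_erase_subset _ _ (mem_insert_self _ _)⟩
  · have hB : x.2 ∈ insert ∅ x.1.parts := (mem_sigma.1 hx).2
    refine Sigma.ext (Finpartition.ext (parts_adjoinToBlock_avoid ha x.1 x.2 hB)) (heq_of_eq ?_)
    rw [part_adjoinToBlock, erase_insert fun h => ha (subset_of_mem_insert_empty_parts hB h)]
  · change insert (insert a ((π.part a).erase a)) _ = π.parts
    rw [insert_erase (π.mem_part_self.2 has)]
    exact insert_part_erase_parts_avoid has π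

/-- The cumulant over the position set `s` of a family of moments `m`, where `m B` stands for
`E(∏_{k ∈ B} X_k)`. -/
def partitionCumulant (m : Finset α → ℝ) (s : Finset α) : ℝ :=
  ∑ π : Finpartition s, (-1 : ℝ) ^ (#π.parts - 1) * ((#π.parts - 1)! : ℝ) * ∏ B ∈ π.parts, m B

theorem partitionCumulant_insert_eq_zero (ha : a ∉ s) (hs : s.Nonempty) {m : Finset α → ℝ} {c : ℝ}
    (h₀ : m ∅ = 1) (hm : ∀ B ⊆ s, m (insert a B) = c * m B) :
    partitionCumulant m (insert a s) = 0 := by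
  rw [partitionCumulant, sum_finpartition_insert ha
    fun p => (-1 : ℝ) ^ (#p - 1) * ((#p - 1)! : ℝ) * ∏ B ∈ p, m B]
  refine sum_eq_zero fun ρ _ => ?_
  have hnew : ∀ B C, insert a B ∉ ρ.parts.erase C := fun B C h =>
    ha (ρ.subset (mem_of_mem_erase h) (mem_insert_self _ _))
  obtain ⟨r, hr⟩ : ∃ r, #ρ.parts = r + 1 :=
    Nat.exists_eq_add_one_of_ne_zero (card_ne_zero.2 (ρ.parts_nonempty hs.ne_empty))
  have hold : ∀ B ∈ ρ.parts, (-1 : ℝ) ^ (#(insert (insert a B) (ρ.parts.erase B)) - 1) *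
      ((#(insert (insert a B) (ρ.parts.erase B)) - 1)! : ℝ) *
        ∏ C ∈ insert (insert a B) (ρ.parts.erase B), m C =
      (-1) ^ r * (r ! : ℝ) * (c * ∏ C ∈ ρ.parts, m C) := fun B hB => by
    rw [card_insert_of_notMem (hnew _ _), card_erase_of_mem hB, prod_insert (hnew _ _),
      hm B (ρ.subset hB), mul_assoc c, mul_prod_erase _ _ hB, hr]
    simp only [Nat.add_sub_cancel]
  -- The `r + 1` old blocks contribute with `(-1) ^ r * r !` each, the new block `{a}` with
  -- `(-1) ^ (r + 1) * (r + 1)!`.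
  rw [sum_insert ρ.empty_notMem_parts, sum_congr rfl hold, sum_const,
    card_insert_of_notMem (hnew _ _), prod_insert (hnew _ _),
    erase_eq_of_notMem ρ.empty_notMem_parts, hm ∅ (empty_subset _), h₀, hr, Nat.add_sub_cancel,
    Nat.factorial_succ, nsmul_eq_mul]
  push_cast
  ring

theorem partitionCumulant_sub_partitionCumulant (hs : s.Nonempty) {m m' : Finset α → ℝ}
    (h : ∀ B ⊂ s, m B = m' B) :
    partitionCumulant m s - partitionCumulant m' s = m s - m' s := by
  have hs' : s ≠ ⊥ := hs.ne_empty
  rw [partitionCumulant, partitionCumulant, ← sum_sub_distrib,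
    sum_eq_single (Finpartition.indiscrete hs')]
  · simp [Finpartition.indiscrete]
  · intro π _ hπ
    have hproper : ∀ B ∈ π.parts, B ⊂ s := fun B hB =>
      (π.subset hB).ssubset_of_ne fun hBs => hπ <| le_antisymm
        (fun C hC => ⟨s, mem_singleton_self s, π.le hC⟩)
        fun C hC => ⟨s, hBs ▸ hB, (mem_singleton.1 hC).le⟩
    rw [prod_congr rfl fun B hB => h B (hproper B hB), sub_self]
  · exact fun h => absurd (mem_univ _) h

theorem partitionCumulant_insert_eq_sub (ha : a ∉ s) (hs : s.Nonempty) {m : Finset α → ℝ} {c : ℝ}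
    (h₀ : m ∅ = 1) (hm : ∀ B ⊂ s, m (insert a B) = c * m B) :
    partitionCumulant m (insert a s) = m (insert a s) - c * m s := by
  let m' : Finset α → ℝ := Function.update m (insert a s) (c * m s)
  have hm' : ∀ B ≠ insert a s, m' B = m B := fun B hB => Function.update_of_ne hB _ _
  have hs' : m' (insert a s) = c * m s := Function.update_self _ _ _
  have hne : ∀ B ⊆ s, B ≠ insert a s := fun B hB h => ha (hB (h ▸ mem_insert_self a s))
  have hzero : partitionCumulant m' (insert a s) = 0 := by
    refine partitionCumulant_insert_eq_zero (c := c) ha hs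
      ((hm' ∅ (hne ∅ (empty_subset s))).trans h₀) fun B hB => ?_
    rw [hm' B (hne B hB)]
    rcases hB.eq_or_ssubset with rfl | hB
    · exact hs'
    · have hBs : insert a B ≠ insert a s := fun h => hB.ne <| by
        rw [← erase_insert fun haB => ha (hB.1 haB), h, erase_insert ha]
      rw [hm' _ hBs, hm B hB]
  rw [← hs', ← partitionCumulant_sub_partitionCumulant (insert_nonempty a s)
    fun B hB => (hm' B hB.ne).symm, hzero, sub_zero]

theorem partitionCumulant_map_perm [Fintype α] (σ : Equiv.Perm α) (m : Finset α → ℝ) :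
    partitionCumulant (fun B => m (B.map σ.toEmbedding)) univ = partitionCumulant m univ := by
  let e : Finset α ≃o Finset α := ⟨σ.finsetCongr, by simp⟩
  let F : Finpartition (univ : Finset α) → Finpartition (univ : Finset α) :=
    fun π => (π.map e).copy (by simp [e])
  have hF : F.Injective := fun π ρ h => Finpartition.ext <|
    Finset.map_injective (e : Finset α ↪ Finset α) (congrArg Finpartition.parts h)
  refine Fintype.sum_bijective F (Finite.injective_iff_bijective.1 hF) _ _ fun π => ?_
  have hparts : (F π).parts = π.parts.map σ.finsetCongr.toEmbedding := rfl
  simp [hparts]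

end PartitionCumulant

section ExponentialMoments

variable {Ω : Type*} [MeasurableSpace Ω] {μ : Measure Ω} {h : Ω → ℝ}

theorem integrable_mul_exp_of_le {Y Z : Ω → ℝ} (hh : AEStronglyMeasurable h μ)
    (hY : AEStronglyMeasurable Y μ) (hint : Integrable (fun ω => h ω * Real.exp (Z ω)) μ)
    (hYZ : Y ≤ Z) : Integrable (fun ω => h ω * Real.exp (Y ω)) μ := by
  refine hint.mono (by fun_prop) (.of_forall fun ω => ?_)
  rw [norm_mul, norm_mul, Real.norm_of_nonneg (Real.exp_nonneg _),
    Real.norm_of_nonneg (Real.exp_nonneg _)]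
  gcongr
  exact hYZ ω

theorem hasSum_pow_div_factorial (x : ℝ) :
    HasSum (fun k : ℕ => x ^ k / (k ! : ℝ)) (Real.exp x) := by
  rw [Real.exp_eq_exp_ℝ]
  exact NormedSpace.expSeries_div_hasSum_exp x

theorem hasSum_integral_mul_pow_div_factorial {Y : Ω → ℝ} (hh : AEStronglyMeasurable h μ)
    (hY : AEStronglyMeasurable Y μ) (hint : Integrable (fun ω => h ω * Real.exp |Y ω|) μ) :
    HasSum (fun k : ℕ => ∫ ω, h ω * (Y ω ^ k / (k ! : ℝ)) ∂μ)
      (∫ ω, h ω * Real.exp (Y ω) ∂μ) := by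
  have hbound : ∀ ω, HasSum (fun k : ℕ => |h ω| * (|Y ω| ^ k / (k ! : ℝ)))
      ‖h ω * Real.exp |Y ω|‖ := fun ω => by
    simpa using (hasSum_pow_div_factorial |Y ω|).mul_left |h ω|
  refine hasSum_integral_of_dominated_convergence
    (fun k ω => |h ω| * (|Y ω| ^ k / (k ! : ℝ))) (fun k => by fun_prop)
    (fun k => .of_forall fun ω => by simp) (.of_forall fun ω => (hbound ω).summable) ?_
    (.of_forall fun ω => (hasSum_pow_div_factorial (Y ω)).mul_left (h ω))
  simpa only [(hbound _).tsum_eq] using hint.norm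

variable {E : Type*} [NormedAddCommGroup E] [NormedSpace ℝ E] {L : Ω → E →L[ℝ] ℝ} {r : ℝ}

/-- The power series of `x ↦ exp (ℓ x)` for a continuous linear form `ℓ`. -/
noncomputable def expLinearSeries (ℓ : E →L[ℝ] ℝ) : FormalMultilinearSeries ℝ E ℝ := fun k =>
  (k ! : ℝ)⁻¹ • (ContinuousMultilinearMap.mkPiAlgebraFin ℝ k ℝ).compContinuousLinearMap fun _ => ℓ

theorem expLinearSeries_apply_const (ℓ : E →L[ℝ] ℝ) (k : ℕ) (x : E) :
    expLinearSeries ℓ k (fun _ => x) = ℓ x ^ k / (k ! : ℝ) := by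
  simp [expLinearSeries, div_eq_inv_mul]

theorem norm_expLinearSeries_mul_pow_le (ℓ : E →L[ℝ] ℝ) (k : ℕ) (hr : 0 ≤ r) :
    ‖expLinearSeries ℓ k‖ * r ^ k ≤ Real.exp (r * ‖ℓ‖) := by
  have hcomp := ContinuousMultilinearMap.norm_compContinuousLinearMap_le
    (ContinuousMultilinearMap.mkPiAlgebraFin ℝ k ℝ) fun _ => ℓ
  rw [ContinuousMultilinearMap.norm_mkPiAlgebraFin, one_mul, prod_const, card_univ,
    Fintype.card_fin] at hcomp
  calc ‖expLinearSeries ℓ k‖ * r ^ k ≤ (k ! : ℝ)⁻¹ * ‖ℓ‖ ^ k * r ^ k := by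
        rw [expLinearSeries, norm_smul, norm_inv, RCLike.norm_natCast]
        gcongr
    _ = (r * ‖ℓ‖) ^ k / (k ! : ℝ) := by ring
    _ ≤ Real.exp (r * ‖ℓ‖) := Real.pow_div_factorial_le_exp _ (by positivity) k

theorem continuous_expLinearSeries (k : ℕ) :
    Continuous fun ℓ : E →L[ℝ] ℝ => expLinearSeries ℓ k := by
  have hcomp : Continuous fun ℓ : E →L[ℝ] ℝ =>
      (ContinuousMultilinearMap.mkPiAlgebraFin ℝ k ℝ).compContinuousLinearMap fun _ => ℓ :=
    (ContinuousMultilinearMap.mkPiAlgebraFin ℝ k ℝ).compContinuousLinearMapLRight.cont.comp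
      (continuous_pi fun _ => continuous_id)
  exact hcomp.const_smul (k ! : ℝ)⁻¹

/-- The expected power series `∑ₖ E(h (L x)ᵏ) / k!` of `x ↦ E(h exp (L x))`, for a random linear
form `L` and a random weight `h`. -/
noncomputable def expMomentSeries (μ : Measure Ω) (h : Ω → ℝ) (L : Ω → E →L[ℝ] ℝ) :
    FormalMultilinearSeries ℝ E ℝ :=
  fun k => ∫ ω, h ω • expLinearSeries (L ω) k ∂μ

theorem norm_smul_expLinearSeries_mul_pow_le (c : ℝ) (ℓ : E →L[ℝ] ℝ) (k : ℕ) (hr : 0 ≤ r) :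
    ‖c • expLinearSeries ℓ k‖ * r ^ k ≤ ‖c * Real.exp (r * ‖ℓ‖)‖ := by
  rw [norm_smul, mul_assoc, norm_mul, Real.norm_of_nonneg (Real.exp_nonneg _)]
  exact mul_le_mul_of_nonneg_left (norm_expLinearSeries_mul_pow_le ℓ k hr) (norm_nonneg c)

theorem integrable_smul_expLinearSeries (hh : AEStronglyMeasurable h μ)
    (hL : AEStronglyMeasurable L μ) (hr : 0 < r)
    (hint : Integrable (fun ω => h ω * Real.exp (r * ‖L ω‖)) μ) (k : ℕ) :
    Integrable (fun ω => h ω • expLinearSeries (L ω) k) μ := by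
  refine (hint.norm.div_const (r ^ k)).mono'
    (hh.smul ((continuous_expLinearSeries k).comp_aestronglyMeasurable hL))
    (.of_forall fun ω => ?_)
  rw [le_div_iff₀ (by positivity)]
  exact norm_smul_expLinearSeries_mul_pow_le _ _ k hr.le

theorem expMomentSeries_apply_const (hh : AEStronglyMeasurable h μ)
    (hL : AEStronglyMeasurable L μ) (hr : 0 < r)
    (hint : Integrable (fun ω => h ω * Real.exp (r * ‖L ω‖)) μ) (k : ℕ) (x : E) :
    expMomentSeries μ h L k (fun _ => x) = ∫ ω, h ω * (L ω x ^ k / (k ! : ℝ)) ∂μ := by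
  rw [expMomentSeries,
    ContinuousMultilinearMap.integral_apply (integrable_smul_expLinearSeries hh hL hr hint k)]
  simp only [_root_.smul_apply, expLinearSeries_apply_const, smul_eq_mul]

theorem hasFPowerSeriesOnBall_integral_mul_exp (hh : AEStronglyMeasurable h μ)
    (hL : AEStronglyMeasurable L μ) (hr : 0 < r)
    (hint : Integrable (fun ω => h ω * Real.exp (r * ‖L ω‖)) μ) :
    HasFPowerSeriesOnBall (fun x => ∫ ω, h ω * Real.exp (L ω x) ∂μ) (expMomentSeries μ h L) 0
      (ENNReal.ofReal r) where
  r_le := by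
    refine FormalMultilinearSeries.le_radius_of_bound _
      (∫ ω, ‖h ω * Real.exp (r * ‖L ω‖)‖ ∂μ) fun k => ?_
    rw [Real.coe_toNNReal r hr.le]
    calc ‖expMomentSeries μ h L k‖ * r ^ k
        ≤ (∫ ω, ‖h ω • expLinearSeries (L ω) k‖ ∂μ) * r ^ k := by
          gcongr
          exact norm_integral_le_integral_norm _
      _ = ∫ ω, ‖h ω • expLinearSeries (L ω) k‖ * r ^ k ∂μ := (integral_mul_const _ _).symm
      _ ≤ ∫ ω, ‖h ω * Real.exp (r * ‖L ω‖)‖ ∂μ :=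
          integral_mono ((integrable_smul_expLinearSeries hh hL hr hint k).norm.mul_const _)
            hint.norm fun ω => norm_smul_expLinearSeries_mul_pow_le _ _ k hr.le
  r_pos := ENNReal.ofReal_pos.2 hr
  hasSum := by
    intro x hx
    have hxr : ‖x‖ ≤ r := by
      rw [Metric.eball_ofReal, mem_ball_zero_iff] at hx
      exact hx.le
    simp only [expMomentSeries_apply_const hh hL hr hint, zero_add]
    have hLx := hL.apply_continuousLinearMap x
    refine hasSum_integral_mul_pow_div_factorial hh hLx
      (integrable_mul_exp_of_le hh (by fun_prop) hint fun ω => ?_)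
    exact ((L ω).le_opNorm_of_le hxr).trans_eq (mul_comm _ _)

theorem fderiv_integral_mul_exp_zero (hh : AEStronglyMeasurable h μ)
    (hL : AEStronglyMeasurable L μ) (hr : 0 < r)
    (hint : Integrable (fun ω => h ω * Real.exp (r * ‖L ω‖)) μ) (v : E) :
    fderiv ℝ (fun x => ∫ ω, h ω * Real.exp (L ω x) ∂μ) 0 v = ∫ ω, h ω * L ω v ∂μ := by
  have hv : (Fin.snoc 0 v : Fin 1 → E) = fun _ => v := funext fun k => by
    simp [Fin.snoc]
  rw [(hasFPowerSeriesOnBall_integral_mul_exp hh hL hr hint).hasFPowerSeriesAt.hasFDerivAt.fderiv,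
    continuousMultilinearCurryFin1_apply]
  refine (congrArg (expMomentSeries μ h L 1) hv).trans ?_
  simp only [expMomentSeries_apply_const hh hL hr hint, pow_one, Nat.factorial_one, Nat.cast_one,
    div_one]

theorem fderiv_integral_exp (hL : AEStronglyMeasurable L μ)
    (hint : Integrable (fun ω => Real.exp (r * ‖L ω‖)) μ) {x : E} (hx : ‖x‖ < r) (v : E) :
    fderiv ℝ (fun x => ∫ ω, Real.exp (L ω x) ∂μ) x v = ∫ ω, L ω v * Real.exp (L ω x) ∂μ := by
  have hLx : AEStronglyMeasurable (fun ω => Real.exp (L ω x)) μ :=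
    Real.continuous_exp.comp_aestronglyMeasurable (hL.apply_continuousLinearMap x)
  have hshift : Integrable (fun ω => Real.exp (L ω x) * Real.exp ((r - ‖x‖) * ‖L ω‖)) μ := by
    refine hint.mono (by fun_prop) (.of_forall fun ω => ?_)
    rw [← Real.exp_add, Real.norm_of_nonneg (Real.exp_nonneg _),
      Real.norm_of_nonneg (Real.exp_nonneg _)]
    gcongr
    linarith [(le_abs_self _).trans ((L ω).le_opNorm x)]
  have hderiv := fderiv_integral_mul_exp_zero hLx hL (sub_pos.2 hx) hshift v
  simp only [← Real.exp_add, ← map_add] at hderiv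
  rw [fderiv_comp_add_left (f := fun x => ∫ ω, Real.exp (L ω x) ∂μ) x, add_zero] at hderiv
  simpa only [mul_comm] using hderiv

end ExponentialMoments

section IteratedDerivatives

variable {E : Type*} [NormedAddCommGroup E] [NormedSpace ℝ E] {f : E → ℝ}

theorem iteratedDeriv_comp_smul_zero (hf : AnalyticAt ℝ f 0) (v : E) (k : ℕ) :
    iteratedDeriv k (fun s : ℝ => f (s • v)) 0 = iteratedFDeriv ℝ k f 0 fun _ => v := by
  obtain ⟨p, r, hp⟩ := hf
  let u : ℝ →L[ℝ] E := ContinuousLinearMap.toSpanSingleton ℝ v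
  have hp' : HasFPowerSeriesOnBall f p (u 0) r := by rwa [map_zero]
  have hline := hp'.compContinuousLinearMap.factorial_smul (1 : ℝ) k
  have hu : (u ∘ fun _ : Fin k => (1 : ℝ)) = fun _ => v := funext fun _ => by simp [u]
  rw [iteratedDeriv_eq_iteratedFDeriv, ← hp.factorial_smul v k, ← hu]
  exact hline.symm

theorem analyticAt_fderiv_apply {x : E} (hf : AnalyticAt ℝ f x) (u : E) :
    AnalyticAt ℝ (fun y => fderiv ℝ f y u) x :=
  (ContinuousLinearMap.analyticAt (ContinuousLinearMap.apply ℝ ℝ u) _).comp hf.fderiv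

theorem analyticAt_fderiv_smul_apply (hf : AnalyticAt ℝ f 0) (u v : E) :
    AnalyticAt ℝ (fun s : ℝ => fderiv ℝ f (s • v) u) 0 :=
  (analyticAt_fderiv_apply hf u).comp_of_eq (by fun_prop) (zero_smul ℝ v)

theorem iteratedFDeriv_cons_const (hf : AnalyticAt ℝ f 0) (u v : E) (k : ℕ) :
    iteratedFDeriv ℝ (k + 1) f 0 (Fin.cons u fun _ => v) =
      iteratedDeriv k (fun s : ℝ => fderiv ℝ f (s • v) u) 0 := by
  have hcomm := (ContinuousLinearMap.apply ℝ ℝ u).iteratedFDeriv_comp_left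
    (hf.fderiv.contDiffAt (n := k)) le_rfl
  rw [iteratedDeriv_comp_smul_zero (analyticAt_fderiv_apply hf u),
    ← hf.contDiffAt.iteratedFDeriv_comp_perm _ (finRotate (k + 1))]
  have hsnoc : (Fin.cons u fun _ => v : Fin (k + 1) → E) ∘ finRotate (k + 1) =
      Fin.snoc (fun _ => v) u := (Fin.snoc_eq_cons_rotate (fun _ => v) u).symm
  rw [hsnoc, iteratedFDeriv_succ_apply_right, Fin.init_snoc, Fin.snoc_last]
  exact (DFunLike.congr_fun hcomm fun _ => v).symm

theorem eventually_eq_self_iff_iteratedDeriv_eq_zero {g : ℝ → ℝ} {x : ℝ} (hg : AnalyticAt ℝ g x) :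
    (∀ᶠ t in 𝓝 x, g t = g x) ↔ ∀ k, iteratedDeriv (k + 1) g x = 0 := by
  have hsub : AnalyticAt ℝ (fun t => g t - g x) x := hg.sub analyticAt_const
  have hk : ∀ k, iteratedDeriv (k + 1) (fun t => g t - g x) x = iteratedDeriv (k + 1) g x :=
    fun k => by
      rw [iteratedDeriv_fun_sub hg.contDiffAt contDiffAt_const, iteratedDeriv_const,
        if_neg k.succ_ne_zero, sub_zero]
  simp only [← sub_eq_zero (b := g x), ← hk]
  rw [← analyticOrderAt_eq_top, ENat.eq_top_iff_forall_ge]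
  simp only [natCast_le_analyticOrderAt_iff_iteratedDeriv_eq_zero hsub]
  refine ⟨fun h k => h (k + 2) (k + 1) (k + 1).lt_succ_self, fun h _ k _ => ?_⟩
  cases k with
  | zero => simp only [iteratedDeriv_zero, sub_self]
  | succ k => exact h k

end IteratedDerivatives

section ConditionalExpectation

open ProbabilityTheory

variable {Ω : Type*} [MeasurableSpace Ω] {P : Measure Ω} {X Y : Ω → ℝ} {r c : ℝ}

theorem map_eq_map_of_mgf_eventuallyEq {Ω' : Type*} [MeasurableSpace Ω'] {μ : Measure Ω}
    {ν : Measure Ω'} [IsFiniteMeasure μ] [IsFiniteMeasure ν] {Z : Ω' → ℝ} (hY : AEMeasurable Y μ)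
    (hZ : AEMeasurable Z ν) (hμ : 0 ∈ interior (integrableExpSet Y μ))
    (hν : 0 ∈ interior (integrableExpSet Z ν)) (h : mgf Y μ =ᶠ[𝓝 0] mgf Z ν) :
    μ.map Y = ν.map Z := by
  let V : Set ℝ := interior (integrableExpSet Y μ) ∩ interior (integrableExpSet Z ν)
  have hV : Convex ℝ V := convex_integrableExpSet.interior.inter convex_integrableExpSet.interior
  have hreal : ∃ᶠ x : ℝ in 𝓝[≠] 0, complexMGF Y μ x = complexMGF Z ν x := by
    refine Filter.Eventually.frequently ?_
    filter_upwards [h.filter_mono nhdsWithin_le_nhds] with x hx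
    rw [complexMGF_ofReal, complexMGF_ofReal, hx]
  have hofReal : Filter.Tendsto (fun x : ℝ => (x : ℂ)) (𝓝[≠] 0) (𝓝[≠] ((0 : ℝ) : ℂ)) :=
    Complex.continuous_ofReal.continuousWithinAt.tendsto_nhdsWithin fun x hx =>
      Complex.ofReal_injective.ne hx
  have hstrip : Set.EqOn (complexMGF Y μ) (complexMGF Z ν) {w | w.re ∈ V} :=
    AnalyticOnNhd.eqOn_of_preconnected_of_frequently_eq
      (fun w hw => analyticAt_complexMGF hw.1) (fun w hw => analyticAt_complexMGF hw.2)
      (hV.linear_preimage Complex.reLm).isPreconnected (z₀ := ((0 : ℝ) : ℂ))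
      ⟨hμ, hν⟩ (hofReal.frequently hreal)
  refine Measure.ext_of_charFun (funext fun t => ?_)
  rw [← complexMGF_mul_I hY, ← complexMGF_mul_I hZ]
  exact hstrip (by simpa [V] using ⟨hμ, hν⟩)

theorem integrable_withDensity_ofReal_iff {h g : Ω → ℝ} (hh : Measurable h) (h₀ : 0 ≤ h) :
    Integrable g (P.withDensity fun ω => ENNReal.ofReal (h ω)) ↔
      Integrable (fun ω => h ω * g ω) P := by
  rw [integrable_withDensity_iff_integrable_smul' hh.ennreal_ofReal
    (.of_forall fun _ => ENNReal.ofReal_lt_top)]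
  simp only [ENNReal.toReal_ofReal (h₀ _), smul_eq_mul]

theorem integral_withDensity_ofReal {h g : Ω → ℝ} (hh : Measurable h) (h₀ : 0 ≤ h) :
    ∫ ω, g ω ∂(P.withDensity fun ω => ENNReal.ofReal (h ω)) = ∫ ω, h ω * g ω ∂P := by
  rw [integral_withDensity_eq_integral_toReal_smul hh.ennreal_ofReal
    (.of_forall fun _ => ENNReal.ofReal_lt_top)]
  simp only [ENNReal.toReal_ofReal (h₀ _), smul_eq_mul]

theorem integrable_mul_exp_mul (hX : AEStronglyMeasurable X P) (hY : AEStronglyMeasurable Y P)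
    (hint : Integrable (fun ω => X ω * Real.exp (r * |Y ω|)) P) {t : ℝ} (ht : |t| ≤ r) :
    Integrable (fun ω => X ω * Real.exp (t * Y ω)) P :=
  integrable_mul_exp_of_le hX (hY.const_mul t) hint fun ω => by
    calc t * Y ω ≤ |t| * |Y ω| := (le_abs_self _).trans_eq (abs_mul _ _)
      _ ≤ r * |Y ω| := by gcongr

theorem eventually_abs_le (hr : 0 < r) : ∀ᶠ t : ℝ in 𝓝 0, |t| ≤ r := by
  filter_upwards [Metric.closedBall_mem_nhds 0 hr] with t ht
  simpa using ht

theorem isFiniteMeasure_withDensity_of_integrable_mul_exp (hX : Measurable X) (hY : Measurable Y)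
    (hr : 0 ≤ r) (hint : Integrable (fun ω => X ω * Real.exp (r * |Y ω|)) P) :
    IsFiniteMeasure (P.withDensity fun ω => ENNReal.ofReal (X ω)) := by
  have hXint := integrable_mul_exp_mul hX.aestronglyMeasurable hY.aestronglyMeasurable hint
    (t := 0) (by rwa [abs_zero])
  simp only [zero_mul, Real.exp_zero, mul_one] at hXint
  exact isFiniteMeasure_withDensity_ofReal hXint.hasFiniteIntegral

theorem zero_mem_interior_integrableExpSet_withDensity (hX : Measurable X) (hX₀ : 0 ≤ X)
    (hY : Measurable Y) (hr : 0 < r) (hint : Integrable (fun ω => X ω * Real.exp (r * |Y ω|)) P) :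
    0 ∈ interior (integrableExpSet Y (P.withDensity fun ω => ENNReal.ofReal (X ω))) := by
  rw [mem_interior_iff_mem_nhds]
  filter_upwards [eventually_abs_le hr] with t ht
  exact (integrable_withDensity_ofReal_iff hX hX₀).2
    (integrable_mul_exp_mul hX.aestronglyMeasurable hY.aestronglyMeasurable hint ht)

theorem setIntegral_preimage_eq_of_integral_mul_exp_eq {f g : Ω → ℝ} (hf : Measurable f)
    (hg : Measurable g) (hf₀ : 0 ≤ f) (hg₀ : 0 ≤ g) (hY : Measurable Y) (hr : 0 < r)
    (hfint : Integrable (fun ω => f ω * Real.exp (r * |Y ω|)) P)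
    (hgint : Integrable (fun ω => g ω * Real.exp (r * |Y ω|)) P)
    (heq : ∀ᶠ t : ℝ in 𝓝 0,
      ∫ ω, f ω * Real.exp (t * Y ω) ∂P = ∫ ω, g ω * Real.exp (t * Y ω) ∂P)
    {A : Set ℝ} (hA : MeasurableSet A) :
    ∫ ω in Y ⁻¹' A, f ω ∂P = ∫ ω in Y ⁻¹' A, g ω ∂P := by
  have := isFiniteMeasure_withDensity_of_integrable_mul_exp hf hY hr.le hfint
  have := isFiniteMeasure_withDensity_of_integrable_mul_exp hg hY hr.le hgint
  have hmgf : mgf Y (P.withDensity fun ω => ENNReal.ofReal (f ω)) =ᶠ[𝓝 0]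
      mgf Y (P.withDensity fun ω => ENNReal.ofReal (g ω)) := by
    filter_upwards [heq] with t ht
    rwa [mgf, mgf, integral_withDensity_ofReal hf hf₀, integral_withDensity_ofReal hg hg₀]
  have hmap := map_eq_map_of_mgf_eventuallyEq hY.aemeasurable hY.aemeasurable
    (zero_mem_interior_integrableExpSet_withDensity hf hf₀ hY hr hfint)
    (zero_mem_interior_integrableExpSet_withDensity hg hg₀ hY hr hgint) hmgf
  have hYA := congrArg (fun ν => (ν A).toReal) hmap
  simp only [Measure.map_apply hY hA, withDensity_apply _ (hY hA)] at hYA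
  rwa [integral_eq_lintegral_of_nonneg_ae (.of_forall hf₀) hf.aestronglyMeasurable,
    integral_eq_lintegral_of_nonneg_ae (.of_forall hg₀) hg.aestronglyMeasurable]

theorem setIntegral_preimage_eq_zero_of_integral_mul_exp_eq_zero (hX : Measurable X)
    (hY : Measurable Y) (hr : 0 < r)
    (hint : Integrable (fun ω => X ω * Real.exp (r * |Y ω|)) P)
    (hzero : ∀ᶠ t : ℝ in 𝓝 0, ∫ ω, X ω * Real.exp (t * Y ω) ∂P = 0)
    {A : Set ℝ} (hA : MeasurableSet A) : ∫ ω in Y ⁻¹' A, X ω ∂P = 0 := by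
  have hXint : ∀ {t : ℝ}, |t| ≤ r → Integrable (fun ω => X ω * Real.exp (t * Y ω)) P :=
    integrable_mul_exp_mul hX.aestronglyMeasurable hY.aestronglyMeasurable hint
  have hX₀ : Integrable X P := by simpa using hXint (t := 0) (by simpa using hr.le)
  have habs : ∀ x y : ℝ, |x| * Real.exp y = |x * Real.exp y| := fun x y => by
    rw [abs_mul, Real.abs_exp]
  -- The two nonnegative weights `X + |X|` and `|X|` differ by `X`.
  have heq := setIntegral_preimage_eq_of_integral_mul_exp_eq (P := P) (f := fun ω => X ω + |X ω|)
    (g := fun ω => |X ω|) (by fun_prop) (by fun_prop)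
    (fun ω => neg_le_iff_add_nonneg.1 (neg_abs_le (X ω))) (fun ω => abs_nonneg (X ω)) hY hr
    (by simpa only [add_mul, habs] using hint.fun_add hint.abs)
    (by simpa only [habs] using hint.abs) (by
      filter_upwards [hzero, eventually_abs_le hr] with t ht htr
      simp only [add_mul, habs]
      rw [integral_add (hXint htr) (hXint htr).abs, ht, zero_add]) hA
  rwa [integral_add hX₀.integrableOn hX₀.abs.integrableOn, add_eq_right] at heq

theorem integral_mul_eq_of_condExp_ae_eq_const [IsFiniteMeasure P] (hY : Measurable Y)
    (hX : Integrable X P)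
    (hc : P[X | MeasurableSpace.comap Y inferInstance] =ᵐ[P] fun _ => c) {g : ℝ → ℝ}
    (hg : Measurable g) (hint : Integrable (fun ω => X ω * g (Y ω)) P) :
    ∫ ω, X ω * g (Y ω) ∂P = c * ∫ ω, g (Y ω) ∂P := by
  have hgY : StronglyMeasurable[MeasurableSpace.comap Y inferInstance] fun ω => g (Y ω) :=
    (hg.comp (comap_measurable Y)).stronglyMeasurable
  rw [← integral_condExp hY.comap_le, ← integral_const_mul]
  refine integral_congr_ae ?_
  filter_upwards [condExp_mul_of_stronglyMeasurable_right hgY hint hX, hc] with ω hpull hω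
  exact hpull.trans (congrArg (· * g (Y ω)) hω)

theorem condExp_ae_eq_const_iff_integral_mul_exp [IsFiniteMeasure P] (hX : Measurable X)
    (hY : Measurable Y) (hr : 0 < r)
    (hXint : Integrable (fun ω => X ω * Real.exp (r * |Y ω|)) P)
    (hint : Integrable (fun ω => Real.exp (r * |Y ω|)) P) :
    P[X | MeasurableSpace.comap Y inferInstance] =ᵐ[P] (fun _ => c) ↔
      ∀ᶠ t : ℝ in 𝓝 0, ∫ ω, X ω * Real.exp (t * Y ω) ∂P = c * ∫ ω, Real.exp (t * Y ω) ∂P := by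
  have hXt : ∀ {t : ℝ}, |t| ≤ r → Integrable (fun ω => X ω * Real.exp (t * Y ω)) P :=
    integrable_mul_exp_mul hX.aestronglyMeasurable hY.aestronglyMeasurable hXint
  have hX₀ : Integrable X P := by simpa using hXt (t := 0) (by simpa using hr.le)
  have hcint : Integrable (fun ω => c * Real.exp (r * |Y ω|)) P := hint.const_mul c
  refine ⟨fun hc => ?_, fun h => ?_⟩
  · filter_upwards [eventually_abs_le hr] with t ht
    exact integral_mul_eq_of_condExp_ae_eq_const hY hX₀ hc
      (g := fun y => Real.exp (t * y)) (by fun_prop) (hXt ht)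
  · refine (ae_eq_condExp_of_forall_setIntegral_eq hY.comap_le hX₀
      (fun _ _ _ => (integrable_const c).integrableOn) ?_ aestronglyMeasurable_const).symm
    rintro _ ⟨A, hA, rfl⟩ _
    have hzero := setIntegral_preimage_eq_zero_of_integral_mul_exp_eq_zero (hX.sub_const c) hY hr
      (by simpa only [sub_mul] using hXint.sub' hcint) (by
        filter_upwards [h, eventually_abs_le hr] with t ht htr
        simp only [sub_mul]
        rw [integral_sub (hXt htr) (integrable_mul_exp_mul aestronglyMeasurable_const
          hY.aestronglyMeasurable hcint htr), integral_const_mul, ht, sub_self]) hA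
    rw [integral_sub hX₀.integrableOn (integrable_const c).integrableOn] at hzero
    exact (sub_eq_zero.1 hzero).symm

theorem condExp_ae_eq_const_of_integral_mul_pow [IsFiniteMeasure P] (hX : Measurable X)
    (hY : Measurable Y) (hr : 0 < r)
    (hXint : Integrable (fun ω => X ω * Real.exp (r * |Y ω|)) P)
    (hint : Integrable (fun ω => Real.exp (r * |Y ω|)) P)
    (hmom : ∀ k : ℕ, ∫ ω, X ω * Y ω ^ k ∂P = c * ∫ ω, Y ω ^ k ∂P) :
    P[X | MeasurableSpace.comap Y inferInstance] =ᵐ[P] fun _ => c := by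
  refine (condExp_ae_eq_const_iff_integral_mul_exp hX hY hr hXint hint).2 ?_
  filter_upwards [eventually_abs_le hr] with t ht
  have hseries : ∀ {h : Ω → ℝ}, AEStronglyMeasurable h P →
      Integrable (fun ω => h ω * Real.exp (r * |Y ω|)) P →
      HasSum (fun k : ℕ => t ^ k / (k ! : ℝ) * ∫ ω, h ω * Y ω ^ k ∂P)
        (∫ ω, h ω * Real.exp (t * Y ω) ∂P) := fun {h} hh hhint => by
    refine (hasSum_integral_mul_pow_div_factorial hh (by fun_prop)
      (integrable_mul_exp_of_le hh (by fun_prop) hhint fun ω => ?_)).congr_fun fun k => ?_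
    · rw [abs_mul]
      gcongr
    · rw [← integral_const_mul]
      refine integral_congr_ae (.of_forall fun ω => ?_)
      ring
  have hone := (hseries (h := fun _ => 1) aestronglyMeasurable_const (by simpa using hint))
  refine (hseries hX.aestronglyMeasurable hXint).unique ?_
  simpa only [hmom, one_mul, mul_left_comm] using hone.mul_left c

end ConditionalExpectation

section MomentCumulants

variable {Ω : Type*} [MeasurableSpace Ω] {P : Measure Ω} {n : ℕ} {z : Ω → Fin n → ℝ} {i j : Fin n}

theorem momentCumulantTensor_mem_symTensor (z : Ω → Fin n → ℝ) (P : Measure Ω) (d : ℕ) :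
    momentCumulantTensor z P d ∈ SymTensor d n := by
  intro σ i
  refine Eq.trans ?_ (partitionCumulant_map_perm σ fun B => ∫ ω, ∏ k ∈ B, z ω (i k) ∂P)
  simp only [prod_map]
  rfl

theorem prod_headIndex (x : Fin n → ℝ) {d : ℕ} {B : Finset (Fin (d + 1))} (hB : 0 ∉ B) :
    ∏ k ∈ B, x (headIndex (d + 1) i j k) = x j ^ #B := by
  rw [← prod_const]
  refine prod_congr rfl fun k hk => ?_
  have hk₀ : (k : ℕ) ≠ 0 := Fin.val_ne_zero_iff.2 (ne_of_mem_of_not_mem hk hB)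
  rw [headIndex, if_neg hk₀]

theorem prod_insert_zero_headIndex (x : Fin n → ℝ) {d : ℕ} {B : Finset (Fin (d + 1))}
    (hB : 0 ∉ B) : ∏ k ∈ insert 0 B, x (headIndex (d + 1) i j k) = x i * x j ^ #B := by
  rw [prod_insert hB, prod_headIndex x hB]
  rfl

theorem momentCumulantTensor_headIndex [IsProbabilityMeasure P] {d : ℕ} {c : ℝ}
    (hc : ∀ k ≤ d, ∫ ω, z ω i * z ω j ^ k ∂P = c * ∫ ω, z ω j ^ k ∂P) :
    momentCumulantTensor z P (d + 2) (headIndex (d + 2) i j) =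
      ∫ ω, z ω i * z ω j ^ (d + 1) ∂P - c * ∫ ω, z ω j ^ (d + 1) ∂P := by
  let tail : Finset (Fin (d + 2)) := univ.erase 0
  have hzero : 0 ∉ tail := notMem_erase 0 univ
  have huniv : insert 0 tail = univ := insert_erase (mem_univ 0)
  have hcard : #tail = d + 1 := by rw [card_erase_of_mem (mem_univ 0), card_fin]; rfl
  have hcumulant := partitionCumulant_insert_eq_sub
    (m := fun B => ∫ ω, ∏ k ∈ B, z ω (headIndex (d + 2) i j k) ∂P) (c := c) hzero
    (card_pos.1 (hcard ▸ d.succ_pos)) (by simp) fun B hB => by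
      simp only [prod_headIndex _ fun h => hzero (hB.1 h),
        prod_insert_zero_headIndex _ fun h => hzero (hB.1 h)]
      exact hc _ (Nat.lt_succ_iff.1 ((card_lt_card hB).trans_eq hcard))
  simp only [prod_headIndex _ hzero, prod_insert_zero_headIndex _ hzero, hcard] at hcumulant
  rwa [huniv] at hcumulant

theorem integrable_mul_pow_of_le {X Y : Ω → ℝ} {k d : ℕ} (hX : Integrable X P)
    (hY : AEStronglyMeasurable Y P) (hd : Integrable (fun ω => X ω * Y ω ^ d) P)
    (hk : k ≤ d) : Integrable (fun ω => X ω * Y ω ^ k) P := by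
  refine (hX.norm.add hd.norm).mono' (hX.1.mul (hY.pow k)) (.of_forall fun ω => ?_)
  have hpow : |Y ω| ^ k ≤ 1 + |Y ω| ^ d := by
    rcases le_total |Y ω| 1 with h | h
    · exact (pow_le_one₀ (abs_nonneg _) h).trans (le_add_of_nonneg_right (by positivity))
    · exact (pow_le_pow_right₀ h hk).trans (le_add_of_nonneg_left zero_le_one)
  calc ‖X ω * Y ω ^ k‖ = |X ω| * |Y ω| ^ k := by rw [norm_mul, norm_pow]; rfl
    _ ≤ |X ω| * (1 + |Y ω| ^ d) := by gcongr
    _ = ‖X ω‖ + ‖X ω * Y ω ^ d‖ := by rw [norm_mul, norm_pow, mul_add, mul_one]; rfl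

theorem integrable_mul_pow_of_momentsExist {d : ℕ} (h : MomentsExist z P (d + 1)) (i j : Fin n) :
    Integrable (fun ω => z ω i * z ω j ^ d) P := by
  refine (h (headIndex (d + 1) i j)).congr (.of_forall fun ω => ?_)
  simp [Fin.prod_univ_succ, headIndex]

theorem momentCumulantTensor_mem_vpmi [IsProbabilityMeasure P] (hz : Measurable z)
    (h : PairwiseMeanIndependent z P) {d : ℕ} (hd : 2 ≤ d) (hmom : MomentsExist z P d) :
    momentCumulantTensor z P d ∈ Vpmi d n := by
  refine ⟨momentCumulantTensor_mem_symTensor z P d, fun i j hij => ?_⟩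
  obtain ⟨d, rfl⟩ := Nat.exists_eq_add_of_le' hd
  obtain ⟨hzi, hcond⟩ := h i j hij
  have hzj : Measurable fun ω => z ω j := by fun_prop
  have hfactor : ∀ k ≤ d + 1, ∫ ω, z ω i * z ω j ^ k ∂P =
      (∫ ω, z ω i ∂P) * ∫ ω, z ω j ^ k ∂P := fun k hk =>
    integral_mul_eq_of_condExp_ae_eq_const hzj hzi hcond (g := fun y => y ^ k) (by fun_prop)
      (integrable_mul_pow_of_le hzi hzj.aestronglyMeasurable
        (integrable_mul_pow_of_momentsExist hmom i j) hk)
  rw [momentCumulantTensor_headIndex fun k hk => hfactor k (hk.trans d.le_succ),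
    hfactor _ le_rfl, sub_self]

theorem integral_mul_pow_eq_of_momentCumulantTensor_headIndex [IsProbabilityMeasure P]
    (h : ∀ d, momentCumulantTensor z P (d + 2) (headIndex (d + 2) i j) = 0) (k : ℕ) :
    ∫ ω, z ω i * z ω j ^ k ∂P = (∫ ω, z ω i ∂P) * ∫ ω, z ω j ^ k ∂P := by
  induction k using Nat.strong_induction_on with
  | _ k ih =>
    cases k with
    | zero => simp
    | succ d =>
      have hd := h d
      rw [momentCumulantTensor_headIndex fun k hk => ih k (Nat.lt_succ_of_le hk)] at hd
      exact sub_eq_zero.1 hd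

end MomentCumulants

section CumulantGenFun

variable {Ω : Type*} [MeasurableSpace Ω] {P : Measure Ω} {n : ℕ} {z : Ω → Fin n → ℝ} {r : ℝ}

/-- The linear form `t ↦ tᵀ x` on `ℝⁿ`, depending continuously on `x`. -/
noncomputable def dotProductForm (n : ℕ) : (Fin n → ℝ) →L[ℝ] (Fin n → ℝ) →L[ℝ] ℝ :=
  (dotProductBilin ℝ ℝ).flip.toContinuousBilinearMap

theorem dotProductForm_apply (x t : Fin n → ℝ) : dotProductForm n x t = t ⬝ᵥ x := rfl

theorem smul_single_dotProduct (s : ℝ) (j : Fin n) (x : Fin n → ℝ) :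
    (s • Pi.single j (1 : ℝ)) ⬝ᵥ x = s * x j := by
  rw [smul_dotProduct, single_one_dotProduct, smul_eq_mul]

theorem tendsto_smul_single_nhds_zero (j : Fin n) :
    Filter.Tendsto (fun s : ℝ => s • (Pi.single j 1 : Fin n → ℝ)) (𝓝 0) (𝓝 0) :=
  Continuous.tendsto' (by fun_prop) _ _ (zero_smul ℝ _)

theorem abs_le_norm_dotProductForm (x : Fin n → ℝ) (j : Fin n) : |x j| ≤ ‖dotProductForm n x‖ := by
  have h := (dotProductForm n x).le_opNorm (Pi.single j 1)
  rwa [dotProductForm_apply, single_one_dotProduct, Pi.norm_single, norm_one, mul_one] at h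

theorem exp_mul_norm_le_one_add_sum (r : ℝ) (x : Fin n → ℝ) :
    Real.exp (r * ‖x‖) ≤ 1 + ∑ j, Real.exp (r * |x j|) := by
  rcases isEmpty_or_nonempty (Fin n) with hn | hn
  · simp [Subsingleton.elim x 0]
  · obtain ⟨j, hj⟩ := (IsGreatest.pi_norm x).1
    rw [← hj]
    exact (single_le_sum (fun k _ => Real.exp_nonneg (r * |x k|)) (mem_univ j)).trans
      (le_add_of_nonneg_left zero_le_one)

theorem eventually_integrable_exp_mul_abs (h : CGFFiniteNearZero z P) (j : Fin n) :
    ∀ᶠ s : ℝ in 𝓝 0, Integrable (fun ω => Real.exp (s * |z ω j|)) P := by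
  have haxis := tendsto_smul_single_nhds_zero j
  have hpos := haxis.eventually h
  simp only [smul_single_dotProduct] at hpos
  filter_upwards [hpos, (continuous_neg.tendsto' (0 : ℝ) 0 neg_zero).eventually hpos] with s hs hs'
  exact ProbabilityTheory.integrable_exp_mul_abs hs hs'

theorem exists_integrable_exp_mul_norm [IsFiniteMeasure P] (hz : AEStronglyMeasurable z P)
    (h : CGFFiniteNearZero z P) : ∃ r > 0, Integrable (fun ω => Real.exp (r * ‖z ω‖)) P := by
  have hcoord := Filter.eventually_all.2 (eventually_integrable_exp_mul_abs h)
  obtain ⟨r, hint, hr⟩ :=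
    ((hcoord.filter_mono nhdsWithin_le_nhds).and (self_mem_nhdsWithin (s := Set.Ioi 0))).exists
  refine ⟨r, hr, ((integrable_const 1).add (integrable_finsetSum univ fun j _ => hint j)).mono'
    (by fun_prop) (.of_forall fun ω => ?_)⟩
  rw [Real.norm_of_nonneg (Real.exp_nonneg _)]
  simpa using exp_mul_norm_le_one_add_sum r (z ω)

theorem exists_integrable_exp_mul_norm_dotProductForm [IsFiniteMeasure P]
    (hz : AEStronglyMeasurable z P) (h : CGFFiniteNearZero z P) :
    ∃ r > 0, Integrable (fun ω => Real.exp (r * ‖dotProductForm n (z ω)‖)) P := by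
  obtain ⟨r, hr, hint⟩ := exists_integrable_exp_mul_norm hz h
  have hL := (dotProductForm n).continuous.comp_aestronglyMeasurable hz
  refine ⟨r / (‖dotProductForm n‖ + 1), by positivity, ?_⟩
  refine hint.mono (by fun_prop) (.of_forall fun ω => ?_)
  rw [Real.norm_of_nonneg (Real.exp_nonneg _), Real.norm_of_nonneg (Real.exp_nonneg _)]
  refine Real.exp_le_exp.2 ?_
  calc r / (‖dotProductForm n‖ + 1) * ‖dotProductForm n (z ω)‖
      ≤ r / (‖dotProductForm n‖ + 1) * ((‖dotProductForm n‖ + 1) * ‖z ω‖) := by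
        gcongr
        exact (dotProductForm n).le_of_opNorm_le (le_add_of_nonneg_right zero_le_one) (z ω)
    _ = r * ‖z ω‖ := by field_simp

theorem mul_exp_half_le (hr : 0 < r) (y : ℝ) :
    y * Real.exp (r / 2 * y) ≤ 2 / r * Real.exp (r * y) := by
  have hy : r / 2 * y ≤ Real.exp (r / 2 * y) := (le_add_of_nonneg_right zero_le_one).trans
    (Real.add_one_le_exp _)
  calc y * Real.exp (r / 2 * y) = 2 / r * (r / 2 * y * Real.exp (r / 2 * y)) := by field_simp
    _ ≤ 2 / r * (Real.exp (r / 2 * y) * Real.exp (r / 2 * y)) := by gcongr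
    _ = 2 / r * Real.exp (r * y) := by rw [← Real.exp_add]; ring_nf

theorem integrable_coord_mul_exp_half (hz : AEStronglyMeasurable z P) (hr : 0 < r)
    (hint : Integrable (fun ω => Real.exp (r * ‖dotProductForm n (z ω)‖)) P) (i j : Fin n) :
    Integrable (fun ω => z ω i * Real.exp (r / 2 * |z ω j|)) P := by
  have hi := (continuous_apply i).comp_aestronglyMeasurable hz
  have hj := (continuous_apply j).comp_aestronglyMeasurable hz
  refine (hint.const_mul (2 / r)).mono' (by fun_prop) (.of_forall fun ω => ?_)
  rw [norm_mul, Real.norm_of_nonneg (Real.exp_nonneg _)]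
  refine le_trans ?_ (mul_exp_half_le hr _)
  gcongr
  · exact abs_le_norm_dotProductForm _ i
  · exact abs_le_norm_dotProductForm _ j

theorem integrable_exp_half_mul_abs_coord (hz : AEStronglyMeasurable z P) (hr : 0 ≤ r)
    (hint : Integrable (fun ω => Real.exp (r * ‖dotProductForm n (z ω)‖)) P) (j : Fin n) :
    Integrable (fun ω => Real.exp (r / 2 * |z ω j|)) P := by
  have hj := (continuous_apply j).comp_aestronglyMeasurable hz
  refine hint.mono (by fun_prop) (.of_forall fun ω => ?_)
  rw [Real.norm_of_nonneg (Real.exp_nonneg _), Real.norm_of_nonneg (Real.exp_nonneg _)]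
  gcongr
  · linarith
  · exact abs_le_norm_dotProductForm _ j

theorem integrable_coord [IsFiniteMeasure P] (hz : AEStronglyMeasurable z P)
    (h : CGFFiniteNearZero z P) (i : Fin n) : Integrable (fun ω => z ω i) P := by
  obtain ⟨r, hr, hint⟩ := exists_integrable_exp_mul_norm_dotProductForm hz h
  have hi := (continuous_apply i).comp_aestronglyMeasurable hz
  simpa using integrable_mul_exp_mul hi hi (integrable_coord_mul_exp_half hz hr hint i i)
    (t := 0) (by simpa using (half_pos hr).le)

theorem analyticAt_integral_exp_dotProduct (hz : AEStronglyMeasurable z P) (hr : 0 < r)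
    (hint : Integrable (fun ω => Real.exp (r * ‖dotProductForm n (z ω)‖)) P) :
    AnalyticAt ℝ (fun t => ∫ ω, Real.exp (t ⬝ᵥ z ω) ∂P) 0 := by
  have hL := (dotProductForm n).continuous.comp_aestronglyMeasurable hz
  have hseries := hasFPowerSeriesOnBall_integral_mul_exp (h := fun _ => 1) (by fun_prop) hL hr
    (by simpa only [one_mul] using hint)
  simpa only [one_mul, dotProductForm_apply] using hseries.analyticAt

theorem analyticAt_cumulantGenFun [IsProbabilityMeasure P] (hz : AEStronglyMeasurable z P)
    (h : CGFFiniteNearZero z P) : AnalyticAt ℝ (cumulantGenFun z P) 0 := by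
  obtain ⟨r, hr, hint⟩ := exists_integrable_exp_mul_norm_dotProductForm hz h
  exact (analyticAt_log (by simp)).comp (analyticAt_integral_exp_dotProduct hz hr hint)

theorem cgfCumulantTensor_mem_symTensor [IsProbabilityMeasure P] (hz : AEStronglyMeasurable z P)
    (h : CGFFiniteNearZero z P) (d : ℕ) : cgfCumulantTensor z P d ∈ SymTensor d n := fun σ i =>
  (analyticAt_cumulantGenFun hz h).contDiffAt.iteratedFDeriv_comp_perm
    (fun k => Pi.single (i k) 1) σ

theorem cgfCumulantTensor_headIndex [IsProbabilityMeasure P] (hz : AEStronglyMeasurable z P)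
    (h : CGFFiniteNearZero z P) (d : ℕ) (i j : Fin n) :
    cgfCumulantTensor z P (d + 1) (headIndex (d + 1) i j) =
      iteratedDeriv d (fun s : ℝ =>
        fderiv ℝ (cumulantGenFun z P) (s • Pi.single j 1) (Pi.single i 1)) 0 := by
  rw [← iteratedFDeriv_cons_const (analyticAt_cumulantGenFun hz h)]
  refine congrArg (iteratedFDeriv ℝ (d + 1) (cumulantGenFun z P) 0) (funext fun k => ?_)
  cases k using Fin.cases <;> rfl

theorem eventually_fderiv_cumulantGenFun_single [IsProbabilityMeasure P]
    (hz : AEStronglyMeasurable z P) (hr : 0 < r)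
    (hint : Integrable (fun ω => Real.exp (r * ‖dotProductForm n (z ω)‖)) P)
    (i j : Fin n) : ∀ᶠ s : ℝ in 𝓝 0,
      fderiv ℝ (cumulantGenFun z P) (s • Pi.single j 1) (Pi.single i 1) =
        (∫ ω, z ω i * Real.exp (s * z ω j) ∂P) / ∫ ω, Real.exp (s * z ω j) ∂P := by
  have hL := (dotProductForm n).continuous.comp_aestronglyMeasurable hz
  have hana := analyticAt_integral_exp_dotProduct hz hr hint
  have haxis := tendsto_smul_single_nhds_zero j
  filter_upwards [haxis.eventually (Metric.ball_mem_nhds 0 hr),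
    haxis.eventually hana.eventually_analyticAt,
    haxis.eventually (hana.continuousAt.eventually_ne (y := 0) (by simp))]
    with s hs hdiff hne
  have hfderiv := fderiv_integral_exp hL hint (mem_ball_zero_iff.1 hs) (Pi.single i 1)
  simp only [dotProductForm_apply] at hfderiv
  change fderiv ℝ (fun t => Real.log (∫ ω, Real.exp (t ⬝ᵥ z ω) ∂P)) _ _ = _
  rw [fderiv.log hdiff.differentiableAt hne, _root_.smul_apply, hfderiv, smul_eq_mul,
    ← div_eq_inv_mul]
  simp only [smul_single_dotProduct, single_one_dotProduct]

theorem condExp_coord_ae_eq_iff_cgfCumulantTensor_headIndex [IsProbabilityMeasure P]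
    (hz : Measurable z) (h : CGFFiniteNearZero z P) (i j : Fin n) :
    P[fun ω => z ω i | MeasurableSpace.comap (fun ω => z ω j) inferInstance]
        =ᵐ[P] (fun _ => ∫ ω, z ω i ∂P) ↔
      ∀ d, cgfCumulantTensor z P (d + 2) (headIndex (d + 2) i j) = 0 := by
  have hz' := hz.aestronglyMeasurable (μ := P)
  obtain ⟨r, hr, hint⟩ := exists_integrable_exp_mul_norm_dotProductForm hz' h
  have hexp := integrable_exp_half_mul_abs_coord hz' hr.le hint j
  let g : ℝ → ℝ := fun s => fderiv ℝ (cumulantGenFun z P) (s • Pi.single j 1) (Pi.single i 1)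
  have hg : AnalyticAt ℝ g 0 := analyticAt_fderiv_smul_apply (analyticAt_cumulantGenFun hz' h) _ _
  have hquot : ∀ᶠ s in 𝓝 0, g s =
      (∫ ω, z ω i * Real.exp (s * z ω j) ∂P) / ∫ ω, Real.exp (s * z ω j) ∂P :=
    eventually_fderiv_cumulantGenFun_single hz' hr hint i j
  have hg₀ : g 0 = ∫ ω, z ω i ∂P := by simpa using hquot.self_of_nhds
  simp only [cgfCumulantTensor_headIndex hz' h]
  rw [← eventually_eq_self_iff_iteratedDeriv_eq_zero hg, hg₀,
    condExp_ae_eq_const_iff_integral_mul_exp (by fun_prop) (by fun_prop) (half_pos hr)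
      (integrable_coord_mul_exp_half hz' hr hint i j) hexp]
  refine Filter.eventually_congr ?_
  filter_upwards [hquot, eventually_abs_le (half_pos hr)] with s hs hsr
  have hpos : 0 < ∫ ω, Real.exp (s * z ω j) ∂P := integral_exp_pos (by
    simpa using integrable_mul_exp_mul (X := fun _ => 1) (by fun_prop) (by fun_prop)
      (by simpa using hexp) hsr)
  rw [hs, div_eq_iff hpos.ne']

theorem pairwiseMeanIndependent_iff_cgfCumulantTensor_mem_vpmi [IsProbabilityMeasure P]
    (hz : Measurable z) (h : CGFFiniteNearZero z P) :
    PairwiseMeanIndependent z P ↔ ∀ d, 2 ≤ d → cgfCumulantTensor z P d ∈ Vpmi d n := by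
  constructor
  · intro hpmi d hd
    refine ⟨cgfCumulantTensor_mem_symTensor hz.aestronglyMeasurable h d, fun i j hij => ?_⟩
    obtain ⟨d, rfl⟩ := Nat.exists_eq_add_of_le' hd
    exact (condExp_coord_ae_eq_iff_cgfCumulantTensor_headIndex hz h i j).1 (hpmi i j hij).2 d
  · exact fun hV i j hij => ⟨integrable_coord hz.aestronglyMeasurable h i,
      (condExp_coord_ae_eq_iff_cgfCumulantTensor_headIndex hz h i j).2 fun d =>
        (hV (d + 2) (Nat.le_add_left 2 d)).2 i j hij⟩

theorem pairwiseMeanIndependent_of_momentCumulantTensor_mem_vpmi [IsProbabilityMeasure P]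
    (hz : Measurable z) (h : CGFFiniteNearZero z P)
    (hV : ∀ d, 2 ≤ d → momentCumulantTensor z P d ∈ Vpmi d n) : PairwiseMeanIndependent z P := by
  have hz' := hz.aestronglyMeasurable (μ := P)
  obtain ⟨r, hr, hint⟩ := exists_integrable_exp_mul_norm_dotProductForm hz' h
  exact fun i j hij => ⟨integrable_coord hz' h i,
    condExp_ae_eq_const_of_integral_mul_pow (by fun_prop) (by fun_prop) (half_pos hr)
      (integrable_coord_mul_exp_half hz' hr hint i j)
      (integrable_exp_half_mul_abs_coord hz' hr.le hint j)
      (integral_mul_pow_eq_of_momentCumulantTensor_headIndex fun d =>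
        (hV (d + 2) (Nat.le_add_left 2 d)).2 i j hij)⟩

end CumulantGenFun

/-- The four parts: the forward direction for cumulants given by moments and for cumulants given by
derivatives of `K_z`, then the converse for each of the two. -/
theorem theorem2p2 {Ω : Type*} [MeasurableSpace Ω] (P : Measure Ω) [IsProbabilityMeasure P]
    {n : ℕ} (z : Ω → Fin n → ℝ) (hz : Measurable z) :
    (PairwiseMeanIndependent z P →
      ∀ d : ℕ, 2 ≤ d → MomentsExist z P d → momentCumulantTensor z P d ∈ Vpmi d n) ∧
    (PairwiseMeanIndependent z P → CGFFiniteNearZero z P →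
      ∀ d : ℕ, 2 ≤ d → cgfCumulantTensor z P d ∈ Vpmi d n) ∧
    (CGFFiniteNearZero z P →
      (∀ d : ℕ, 2 ≤ d → momentCumulantTensor z P d ∈ Vpmi d n) →
      PairwiseMeanIndependent z P) ∧
    (CGFFiniteNearZero z P →
      (∀ d : ℕ, 2 ≤ d → cgfCumulantTensor z P d ∈ Vpmi d n) →
      PairwiseMeanIndependent z P) := by
  refine ⟨fun h d => momentCumulantTensor_mem_vpmi hz h, fun h hK => ?_,
    pairwiseMeanIndependent_of_momentCumulantTensor_mem_vpmi hz, fun hK => ?_⟩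
  · exact (pairwiseMeanIndependent_iff_cgfCumulantTensor_mem_vpmi hz hK).1 h
  · exact (pairwiseMeanIndependent_iff_cgfCumulantTensor_mem_vpmi hz hK).2
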